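/- Consider the $3$-uniform hypergraphs $\mathcal{T}=\{v_1v_2v_3,\,v_2v_3v_4,\,v_3v_4v_5\}$ (tight path), $\mathcal{M}=\{v_1v_2v_3,\,v_2v_3v_4,\,v_4v_5v_6\}$ (messy path) and $\mathcal{L}=\{v_1v_2v_3,\,v_3v_4v_5,\,v_5v_6v_7\}$ (loose path), where the $v_i$ are distinct vertices. Let $K^{(3)}_{n,n,n}$ be the complete $3$-partite $3$-uniform hypergraph whose three disjoint partite sets have $n$ vertices each and whose edges are all the $3$-element vertex sets that contain exactly one vertex of each partite set. For a $3$-uniform hypergraph $G$, let $ar(K^{(3)}_{n,n,n},G)$ be the minimum integer $k\ge 0$ such that every (not necessarily proper) edge-coloring of $K^{(3)}_{n,n,n}$ in which at least $k$ distinct colors occur contains a rainbow copy of $G$, that is, a copy of $G$ whose edges have pairwise distinct colors. Then for every integer $n\ge 3$, $$ar(K^{(3)}_{n,n,n},\mathcal{M})=n+1 \qquad\text{and}\qquad ar(K^{(3)}_{n,n,n},\mathcal{T})=ar(K^{(3)}_{n,n,n},\mathcal{L})=n+2.$$ -/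

import Mathlib

namespace AntiRamsey

/-- The complete `r`-partite `r`-uniform hypergraph `K^{(r)}_{n,…,n}`: the `i`-th partite set is
`{i} × Fin n`, and the edges are the `r`-element vertex sets that meet every partite set in exactly
one vertex. -/
def completePartite (r n : ℕ) : Hypergraph (Fin r × Fin n) where
  vertexSet := Set.univ
  edgeSet := {e | e.ncard = r ∧ ∀ i : Fin r, (e ∩ {v | v.1 = i}).ncard = 1}
  subset_vertexSet_of_mem_edgeSet' := fun e _ => Set.subset_univ e

/-- The tight path `𝒯 = {v₁v₂v₃, v₂v₃v₄, v₃v₄v₅}` (vertices numbered from `0`). -/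
def tightPath : Hypergraph (Fin 5) where
  vertexSet := Set.univ
  edgeSet := {{0, 1, 2}, {1, 2, 3}, {2, 3, 4}}
  subset_vertexSet_of_mem_edgeSet' := fun e _ => Set.subset_univ e

/-- The messy path `ℳ = {v₁v₂v₃, v₂v₃v₄, v₄v₅v₆}` (vertices numbered from `0`). -/
def messyPath : Hypergraph (Fin 6) where
  vertexSet := Set.univ
  edgeSet := {{0, 1, 2}, {1, 2, 3}, {3, 4, 5}}
  subset_vertexSet_of_mem_edgeSet' := fun e _ => Set.subset_univ e

/-- The loose path `ℒ = {v₁v₂v₃, v₃v₄v₅, v₅v₆v₇}` (vertices numbered from `0`). -/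
def loosePath : Hypergraph (Fin 7) where
  vertexSet := Set.univ
  edgeSet := {{0, 1, 2}, {2, 3, 4}, {4, 5, 6}}
  subset_vertexSet_of_mem_edgeSet' := fun e _ => Set.subset_univ e

/-- The edge-colouring `c` of `H` contains a rainbow copy of `G`: some injection `φ` of the vertices
of `G` into those of `H` sends every edge of `G` to an edge of `H`, and the edges of this copy
receive pairwise distinct colours. -/
def HasRainbowCopy {α β : Type*} (H : Hypergraph α) (c : H.edgeSet → ℕ) (G : Hypergraph β) :
    Prop :=
  ∃ φ : β → α, Set.MapsTo φ G.vertexSet H.vertexSet ∧ Set.InjOn φ G.vertexSet ∧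
    ∃ hφ : ∀ e ∈ G.edgeSet, φ '' e ∈ H.edgeSet,
      Function.Injective fun e : G.edgeSet => c ⟨φ '' e.1, hφ e.1 e.2⟩

/-- `k` is the anti-Ramsey number `ar(H, G)` of a hypergraph `H` with finitely many edges: the
least `k` such that every edge-colouring of `H` in which at least `k` colours occur contains a
rainbow copy of `G`. -/
def IsAntiRamseyNumber {α β : Type*} (H : Hypergraph α) (G : Hypergraph β) (k : ℕ) : Prop :=
  IsLeast {k : ℕ | ∀ c : H.edgeSet → ℕ, k ≤ (Set.range c).ncard → HasRainbowCopy H c G} k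

end AntiRamsey

/-!
An edge of `K_{n,n,n}` picks one vertex in each partite set, so it is a cell of the cube `[n]³`, and
three edges form a tight, messy or loose path exactly when their Hamming distances are `(1, 1, 2)`,
`(1, 2, 3)` or `(2, 2, 3)`.

Suppose a colouring has no rainbow tight or no rainbow messy path. A line with three colours forces
all parallel lines to repeat its pattern, so the colour depends on one coordinate only and there are
at most `n` colours. If no line has three colours, then no plane does in the tight case, and
parallel planes contribute at most one new colour each; in the messy case the colours of a
two-coloured line propagate to the whole cube.

If there is no rainbow loose path, then no three cells at pairwise distance at least two are
rainbow, whence any two pairs of colours, each seen at distance at least two, share a colour. With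
more than three colours such pairs form a star. Removing its centre, representatives of the other
colours are pairwise at distance one, hence lie on a line.

The colouring by one coordinate is extremal for the messy path. For the other two, a diagonal
(distances `3` only) or a line (distances `1` only) gets `n` private colours and everything else one
further colour.
-/

namespace AntiRamsey

open Function

variable {ι α κ : Type*}

theorem forall_of_forall_update [Finite ι] [DecidableEq ι] {P : (ι → α) → Prop} {x : ι → α}
    (hx : P x) (hP : ∀ y i a, P y → P (update y i a)) (y : ι → α) : P y := by
  cases nonempty_fintype ι
  suffices ∀ s : Finset ι, P (s.piecewise y x) by simpa using this Finset.univ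
  intro s
  induction s using Finset.induction_on with
  | empty => simpa using hx
  | insert i s _ ih => rw [Finset.piecewise_insert]; exact hP _ _ _ ih

theorem exists_apply_update_ne [Finite ι] [DecidableEq ι] {f : (ι → α) → κ} {x y : ι → α}
    (hxy : f x ≠ f y) : ∃ z i a, f (update z i a) ≠ f z := by
  by_contra! h
  exact hxy (forall_of_forall_update (P := fun z ↦ f x = f z) rfl
    (fun z i a hz ↦ hz.trans (h z i a).symm) y)

theorem ncard_range_le_of_dependsOn [Finite α] {f : (ι → α) → κ} {i : ι} (hf : DependsOn f {i}) :
    (Set.range f).ncard ≤ Nat.card α := by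
  have hsub : Set.range f ⊆ Set.range fun a ↦ f fun _ ↦ a := by
    rintro _ ⟨x, rfl⟩
    exact ⟨x i, hf (by simp)⟩
  exact (Set.ncard_le_ncard hsub (Set.finite_range _)).trans (Finite.card_range_le _)

theorem exists_forall_ne (hα : 3 ≤ ENat.card α) (x y : ι → α) :
    ∃ z : ι → α, ∀ i, z i ≠ x i ∧ z i ≠ y i := by
  choose z hz using fun i ↦ ENat.exists_ne_ne_of_three_le hα (x i) (y i)
  exact ⟨z, hz⟩

section Hamming

variable [Fintype ι] [DecidableEq α]

theorem hammingDist_eq_card_iff {x y : ι → α} :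
    hammingDist x y = Fintype.card ι ↔ ∀ i, x i ≠ y i := by
  simp [hammingDist, ← Finset.card_univ, Finset.card_filter_eq_iff]

theorem hammingDist_eq_card_sub_one {x y : ι → α} {i : ι} (hi : x i = y i)
    (h : ∀ j ≠ i, x j ≠ y j) : hammingDist x y = Fintype.card ι - 1 := by
  classical
  rw [hammingDist, ← Finset.card_univ, ← Finset.card_erase_of_mem (Finset.mem_univ i)]
  congr 1
  ext j
  by_cases hj : j = i <;> simp_all

theorem hammingDist_update_self [DecidableEq ι] {x : ι → α} {i : ι} {a : α} (ha : a ≠ x i) :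
    hammingDist (update x i a) x = 1 := by
  rw [hammingDist, Finset.card_eq_one]
  exact ⟨i, by ext j; by_cases hj : j = i <;> simp_all⟩

theorem hammingDist_update_update [DecidableEq ι] {x : ι → α} {i j : ι} {a b : α} (hij : i ≠ j)
    (ha : a ≠ x i) (hb : b ≠ x j) : hammingDist (update x i a) (update x j b) = 2 := by
  rw [hammingDist, Finset.card_eq_two]
  refine ⟨i, j, hij, ?_⟩
  ext l
  by_cases hi : l = i <;> by_cases hj : l = j <;> simp_all [eq_comm]

theorem hammingDist_eq_one_iff [DecidableEq ι] {x y : ι → α} :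
    hammingDist x y = 1 ↔ ∃ i a, x i ≠ a ∧ y = update x i a := by
  constructor
  · intro h
    obtain ⟨i, hi⟩ := Finset.card_eq_one.mp h
    have mem_iff (j : ι) : x j ≠ y j ↔ j = i := by simpa using Finset.ext_iff.mp hi j
    refine ⟨i, y i, (mem_iff i).2 rfl, eq_update_iff.2 ⟨rfl, fun j hj ↦ ?_⟩⟩
    by_contra hne
    exact hj ((mem_iff j).1 (Ne.symm hne))
  · rintro ⟨i, a, ha, rfl⟩
    rw [hammingDist_comm, hammingDist_update_self ha.symm]

end Hamming

/-- No three cells `x`, `y`, `z` at Hamming distances `d(x, y) = p`, `d(y, z) = q` and `d(x, z) = s`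
receive three distinct colours. The tight, messy and loose paths correspond to `(p, q, s)` being
`(1, 1, 2)`, `(1, 2, 3)` and `(2, 2, 3)`, and `(1, 1, 1)` forbids three colours on a line. -/
def RainbowFree [Fintype ι] [DecidableEq α] (f : (ι → α) → κ) (p q s : ℕ) : Prop :=
  ∀ ⦃x y z : ι → α⦄, hammingDist x y = p → hammingDist y z = q → hammingDist x z = s →
    f x = f y ∨ f y = f z ∨ f x = f z

section Tight

variable [Fintype ι] [DecidableEq α] {f : (ι → α) → κ}

theorem RainbowFree.not_rainbow_corner [DecidableEq ι] (hf : RainbowFree f 1 1 2) {i j : ι}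
    (hij : i ≠ j) (x : ι → α) (a b : α) :
    f (update x i a) = f x ∨ f x = f (update x j b) ∨ f (update x i a) = f (update x j b) := by
  by_cases ha : a = x i
  · simp [ha]
  by_cases hb : b = x j
  · simp [hb]
  exact hf (hammingDist_update_self ha) ((hammingDist_comm _ _).trans (hammingDist_update_self hb))
    (hammingDist_update_update hij ha hb)

theorem RainbowFree.eq_or_eq_of_line [DecidableEq ι] (hf : RainbowFree f 1 1 1) {x : ι → α}
    {i : ι} {a : α} (hne : f x ≠ f (update x i a)) (b : α) :
    f (update x i b) = f x ∨ f (update x i b) = f (update x i a) := by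
  rcases eq_or_ne b (x i) with rfl | hb
  · simp
  rcases eq_or_ne b a with rfl | hba
  · simp
  have ha : a ≠ x i := by rintro rfl; simp at hne
  have hdist : hammingDist (update x i b) (update x i a) = 1 := by
    simpa using hammingDist_update_self (x := update x i a) (i := i) (by simpa using hba)
  have := hf (hammingDist_update_self hb) ((hammingDist_comm _ _).trans
    (hammingDist_update_self ha)) hdist
  grind

theorem exists_rainbow_line_of_not_rainbowFree [DecidableEq ι] (hf : ¬ RainbowFree f 1 1 1) :
    ∃ x i a b, f x ≠ f (update x i a) ∧ f (update x i a) ≠ f (update x i b) ∧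
      f x ≠ f (update x i b) := by
  simp only [RainbowFree, not_forall, not_or] at hf
  obtain ⟨x, y, z, hxy, hyz, hxz, hne⟩ := hf
  obtain ⟨i, a, ha, rfl⟩ := hammingDist_eq_one_iff.1 hxy
  obtain ⟨j, b, hb, rfl⟩ := hammingDist_eq_one_iff.1 hxz
  obtain rfl : i = j := by
    by_contra hij
    simp [hammingDist_update_update hij ha.symm hb.symm] at hyz
  exact ⟨x, i, a, b, hne⟩

theorem RainbowFree.exists_dependsOn_of_tight (hf : RainbowFree f 1 1 2)
    (hline : ¬ RainbowFree f 1 1 1) : ∃ i, DependsOn f {i} := by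
  classical
  obtain ⟨x, i, a, b, hxa, hab, hxb⟩ := exists_rainbow_line_of_not_rainbowFree hline
  have parallel (y : ι → α) : ∀ t, f (update y i t) = f (update x i t) := by
    induction y using forall_of_forall_update (x := x) with
    | hx => exact fun _ ↦ rfl
    | hP y j c hy =>
      intro t
      rcases eq_or_ne i j with rfl | hij
      · simpa using hy t
      rw [update_comm hij.symm, ← hy t]
      by_contra hne
      have two_colors (s : α) : f (update x i s) = f (update y i t) ∨
          f (update x i s) = f (update (update y i t) j c) := by
        have := hf.not_rainbow_corner hij (update y i t) s c
        grind [update_idem]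
      have := two_colors (x i)
      grind [two_colors a, two_colors b, update_eq_self]
  refine ⟨i, fun y z hyz ↦ ?_⟩
  rw [← update_eq_self i y, ← update_eq_self i z, parallel y, parallel z, hyz i rfl]

theorem RainbowFree.eq_or_eq_of_update [DecidableEq ι] (hf : RainbowFree f 1 1 2)
    (hline : RainbowFree f 1 1 1) {i j : ι} (hij : i ≠ j) {x : ι → α} {a : α}
    (hxa : f x ≠ f (update x i a)) (b c : α) :
    f (update (update x i b) j c) = f x ∨
      f (update (update x i b) j c) = f (update x i a) := by
  have hb := hline.eq_or_eq_of_line hxa b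
  have ha := hf.not_rainbow_corner hij (update x i b) a c
  have hx := hf.not_rainbow_corner hij (update x i b) (x i) c
  simp only [update_idem, update_eq_self] at ha hx
  grind

end Tight

theorem eq_or_eq_or_eq_of_ne {i j k : Fin 3} (hij : i ≠ j) (hik : i ≠ k) (hjk : j ≠ k)
    (l : Fin 3) : l = i ∨ l = j ∨ l = k := by
  lia

theorem exists_ne_ne (i j : Fin 3) : ∃ k, k ≠ i ∧ k ≠ j := by
  decide +revert

theorem update_update_eq {i j k : Fin 3} (hij : i ≠ j) (hik : i ≠ k) (hjk : j ≠ k)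
    {x y : Fin 3 → α} (h : x k = y k) : update (update x i (y i)) j (y j) = y := by
  ext l
  rcases eq_or_eq_or_eq_of_ne hij hik hjk l with rfl | rfl | rfl <;> simp [*, Ne.symm]

theorem update_eq_update {i j k : Fin 3} (hij : i ≠ j) (hik : i ≠ k) (hjk : j ≠ k)
    {x y : Fin 3 → α} (h : x j = y j) : update x k (y k) = update y i (x i) := by
  ext l
  rcases eq_or_eq_or_eq_of_ne hij hik hjk l with rfl | rfl | rfl <;> simp [*, Ne.symm]

theorem hammingDist_fin_three [DecidableEq α] {i j k : Fin 3} (hij : i ≠ j) (hik : i ≠ k)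
    (hjk : j ≠ k) (x y : Fin 3 → α) : hammingDist x y =
      (if x i = y i then 0 else 1) + (if x j = y j then 0 else 1) +
        (if x k = y k then 0 else 1) := by
  have huniv : (Finset.univ : Finset (Fin 3)) = {i, j, k} := by decide +revert
  rw [hammingDist, Finset.card_filter, huniv]
  simp [hij, hik, hjk, add_assoc]

theorem RainbowFree.not_rainbow_plane [DecidableEq α] {f : (Fin 3 → α) → κ}
    (hf : RainbowFree f 1 1 2) (hline : RainbowFree f 1 1 1) {k : Fin 3} {x y z : Fin 3 → α}
    (hxy : x k = y k) (hyz : y k = z k) : f x = f y ∨ f y = f z ∨ f x = f z := by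
  obtain ⟨i, hik, -⟩ := exists_ne_ne k k
  obtain ⟨j, hji, hjk⟩ := exists_ne_ne i k
  have reach {x y : Fin 3 → α} (h : x k = y k) : update (update x i (y i)) j (y j) = y :=
    update_update_eq hji.symm hik hjk h
  have reach' {x y : Fin 3 → α} (h : x k = y k) : update (update x j (y j)) i (y i) = y :=
    update_update_eq hji hjk hik h
  by_cases hu : f x = f (update x i (y i))
  · rw [or_iff_not_imp_left]
    intro hne
    have hne' : f (update x i (y i)) ≠ f (update (update x i (y i)) j (y j)) := by
      rwa [reach hxy, ← hu]
    have hz := hf.eq_or_eq_of_update hline hji hne' (z j) (z i)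
    rw [reach' (by simpa [hik.symm] using hxy.trans hyz), reach hxy] at hz
    grind
  · have hy := hf.eq_or_eq_of_update hline hji.symm hu (y i) (y j)
    have hz := hf.eq_or_eq_of_update hline hji.symm hu (z i) (z j)
    rw [reach hxy] at hy
    rw [reach (hxy.trans hyz)] at hz
    grind

section Plane

variable {f : (Fin 3 → α) → κ}
  (hf : ∀ ⦃k x y z⦄, x k = y k → y k = z k → f x = f y ∨ f y = f z ∨ f x = f z)

include hf

/-- The plane through `x` contains no third colour, which frees `r` to be the second colour there:
all colours but `f x` then occur among the values of `r`. -/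
theorem exists_third_color_of_plane {x : Fin 3 → α} {i k : Fin 3} {a : α} (hik : i ≠ k)
    (hne : f x ≠ f (update x i a)) (c : α) : ∃ r, (c = x k → r = f (update x i a)) ∧
      ∀ z, z k = c → f z = f x ∨ f z = f (update x i a) ∨ f z = r := by
  rcases eq_or_ne c (x k) with rfl | hc
  · refine ⟨_, fun _ ↦ rfl, fun z hz ↦ ?_⟩
    have := @hf k (update x i a) x z (by simp [hik.symm]) hz.symm
    grind
  obtain ⟨j, hji, hjk⟩ := exists_ne_ne i k
  have hu : f (update x k c) = f x ∨ f (update x k c) = f (update x i a) := by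
    have := @hf j x (update x i a) (update x k c) (by simp [hji]) (by simp [hji, hjk])
    grind
  by_cases hz : ∃ z, z k = c ∧ f z ≠ f x ∧ f z ≠ f (update x i a)
  · obtain ⟨z, hzk, hzx, hza⟩ := hz
    refine ⟨f z, fun h ↦ absurd h hc, fun w hw ↦ ?_⟩
    have := @hf k (update x k c) z w (by simp [hzk]) (hzk.trans hw.symm)
    grind
  · exact ⟨f (update x i a), fun _ ↦ rfl, fun w hw ↦ by grind⟩

theorem ncard_range_le_add_one_of_plane [Finite α] : (Set.range f).ncard ≤ Nat.card α + 1 := by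
  by_cases hconst : ∀ x y, f x = f y
  · exact (ncard_range_le_of_dependsOn (i := 0) fun x y _ ↦ hconst x y).trans (Nat.le_succ _)
  push Not at hconst
  obtain ⟨_, _, hne⟩ := hconst
  obtain ⟨x, i, a, hne⟩ := exists_apply_update_ne hne
  obtain ⟨k, hki, -⟩ := exists_ne_ne i i
  choose r hr hfr using exists_third_color_of_plane hf hki.symm hne.symm
  have hsub : Set.range f ⊆ insert (f x) (Set.range r) := by
    rintro _ ⟨z, rfl⟩
    rcases hfr (z k) z rfl with h | h | h
    · exact Or.inl h
    · exact Or.inr ⟨x k, (hr _ rfl).trans h.symm⟩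
    · exact Or.inr ⟨z k, h.symm⟩
  calc (Set.range f).ncard ≤ (insert (f x) (Set.range r)).ncard :=
        Set.ncard_le_ncard hsub ((Set.finite_range r).insert _)
    _ ≤ (Set.range r).ncard + 1 := Set.ncard_insert_le _ _
    _ ≤ Nat.card α + 1 := by gcongr; exact Finite.card_range_le r

end Plane

theorem RainbowFree.ncard_range_le_of_tight [Finite α] [DecidableEq α] {f : (Fin 3 → α) → κ}
    (hf : RainbowFree f 1 1 2) : (Set.range f).ncard ≤ Nat.card α + 1 := by
  by_cases hline : RainbowFree f 1 1 1
  · exact ncard_range_le_add_one_of_plane fun _ _ _ _ ↦ hf.not_rainbow_plane hline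
  · obtain ⟨i, hi⟩ := hf.exists_dependsOn_of_tight hline
    exact (ncard_range_le_of_dependsOn hi).trans (Nat.le_succ _)

section Messy

section General

variable [Fintype ι] [DecidableEq α] {f : (ι → α) → κ}

theorem RainbowFree.not_rainbow_opposite [DecidableEq ι]
    (hf : RainbowFree f 1 (Fintype.card ι - 1) (Fintype.card ι)) {x z : ι → α} {i : ι}
    (hz : ∀ l ≠ i, x l ≠ z l) (a : α) :
    f (update x i a) = f (update x i (z i)) ∨ f (update x i (z i)) = f z ∨
      f (update x i a) = f z := by
  by_cases ha : a = z i
  · simp [ha]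
  refine hf ?_ (hammingDist_eq_card_sub_one (by simp) (i := i) fun l hl ↦ ?_)
    (hammingDist_eq_card_iff.2 fun l ↦ ?_)
  · simpa using hammingDist_update_self (x := update x i (z i)) (i := i) (by simpa using ha)
  · simpa [hl] using hz l hl
  · rcases eq_or_ne l i with rfl | hl
    · simpa using ha
    · simpa [hl] using hz l hl

theorem RainbowFree.exists_dependsOn_of_messy
    (hf : RainbowFree f 1 (Fintype.card ι - 1) (Fintype.card ι)) (hα : 3 ≤ ENat.card α)
    (hline : ¬ RainbowFree f 1 1 1) : ∃ i, DependsOn f {i} := by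
  classical
  obtain ⟨x, i, a, b, hxa, hab, hxb⟩ := exists_rainbow_line_of_not_rainbowFree hline
  have opposite {z : ι → α} (hz : ∀ l ≠ i, x l ≠ z l) : f z = f (update x i (z i)) := by
    have hx := hf.not_rainbow_opposite hz (x i)
    rw [update_eq_self] at hx
    have ha := hf.not_rainbow_opposite hz a
    have hb := hf.not_rainbow_opposite hz b
    grind
  have apply_eq (y : ι → α) : f y = f (update x i (y i)) := by
    obtain ⟨z, hz⟩ := exists_forall_ne hα x y
    have parallel (t : α) : f (update z i t) = f (update x i t) := by
      simpa using opposite (z := update z i t) fun l hl ↦ by simpa [hl] using (hz l).1.symm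
    have hx := hf.not_rainbow_opposite (x := z) (z := y) (i := i) (fun l _ ↦ (hz l).2) (x i)
    have ha := hf.not_rainbow_opposite (x := z) (z := y) (i := i) (fun l _ ↦ (hz l).2) a
    have hb := hf.not_rainbow_opposite (x := z) (z := y) (i := i) (fun l _ ↦ (hz l).2) b
    simp only [parallel, update_eq_self] at hx ha hb
    grind
  refine ⟨i, fun y z hyz ↦ ?_⟩
  rw [apply_eq y, apply_eq z, hyz i rfl]

theorem RainbowFree.eq_or_eq_of_opposite [DecidableEq ι]
    (hf : RainbowFree f 1 (Fintype.card ι - 1) (Fintype.card ι)) (hline : RainbowFree f 1 1 1)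
    {x z : ι → α} {i : ι} {a : α} (hne : f x ≠ f (update x i a)) (hz : ∀ l ≠ i, x l ≠ z l) :
    f z = f x ∨ f z = f (update x i a) := by
  have hzi := hline.eq_or_eq_of_line hne (z i)
  have hx := hf.not_rainbow_opposite hz (x i)
  have ha := hf.not_rainbow_opposite hz a
  rw [update_eq_self] at hx
  grind

end General

theorem RainbowFree.not_rainbow_skew [DecidableEq α] {f : (Fin 3 → α) → κ}
    (hf : RainbowFree f 1 2 3) {i j k : Fin 3} (hij : i ≠ j) (hik : i ≠ k) (hjk : j ≠ k)
    {w x : Fin 3 → α} {b : α}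
    (hi : w i ≠ x i) (hj : w j = x j) (hk : w k ≠ x k) (hb : b ≠ w j) :
    f (update w j b) = f w ∨ f w = f x ∨ f (update w j b) = f x := by
  apply hf <;> rw [hammingDist_fin_three hij hik hjk] <;> grind

theorem RainbowFree.eq_or_eq_of_messy [DecidableEq α] {f : (Fin 3 → α) → κ}
    (hf : RainbowFree f 1 2 3) (hα : 3 ≤ ENat.card α) (hline : RainbowFree f 1 1 1)
    {x : Fin 3 → α} {i : Fin 3} {a : α} (hne : f x ≠ f (update x i a)) (w : Fin 3 → α) :
    f w = f x ∨ f w = f (update x i a) := by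
  by_contra! hw
  have hij : ∃ j ≠ i, x j = w j := by
    by_contra! h
    exact not_or.2 hw (hf.eq_or_eq_of_opposite hline hne h)
  obtain ⟨j, hji, hj⟩ := hij
  obtain ⟨k, hki, hkj⟩ := exists_ne_ne i j
  have hm : update w k (x k) = update x i (w i) :=
    update_eq_update hji.symm hki.symm hkj.symm hj.symm
  have hmem := hline.eq_or_eq_of_line hne (w i)
  have hk : x k ≠ w k := by
    intro hk
    rw [← hm, hk, update_eq_self] at hmem
    grind
  obtain ⟨z, hz⟩ := exists_forall_ne hα x w
  have hu : f (update w j (z j)) = f x ∨ f (update w j (z j)) = f (update x i a) := by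
    refine hf.eq_or_eq_of_opposite hline hne fun l hl ↦ ?_
    rcases eq_or_eq_or_eq_of_ne hji.symm hki.symm hkj.symm l with rfl | rfl | rfl
    · contradiction
    · simpa using (hz l).1.symm
    · simpa [hkj] using hk
  have hum : f (update w j (z j)) ≠ f (update x i (w i)) := by
    have skew {b : α} (hb : f (update x i b) ≠ f (update x i (w i))) :=
      hf.not_rainbow_skew hji.symm hki.symm hkj.symm (w := w) (x := update x i b) (b := z j)
        (by grind) (by simp [hji, hj]) (by simp [hki, hk.symm]) (hz j).2
    have hx := @skew (x i)
    have ha := @skew a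
    rw [update_eq_self] at hx
    grind
  -- `z` is opposite to three lines, each carrying two colours, and no colour lies on all three.
  have hzx := hf.eq_or_eq_of_opposite hline hne fun l _ ↦ (hz l).1.symm
  have hzm := hf.eq_or_eq_of_opposite hline (x := w) (i := k) (a := x k) (z := z)
    (by grind) fun l _ ↦ (hz l).2.symm
  have hzu := hf.eq_or_eq_of_opposite hline (x := w) (i := j) (a := z j) (z := z)
    (by grind) fun l _ ↦ (hz l).2.symm
  grind

theorem RainbowFree.ncard_range_le_of_messy [DecidableEq α] {f : (Fin 3 → α) → κ}
    (hf : RainbowFree f 1 2 3) (hα : 3 ≤ Nat.card α) : (Set.range f).ncard ≤ Nat.card α := by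
  have : Finite α := Nat.finite_of_card_ne_zero (by lia)
  have hα' : 3 ≤ ENat.card α := by rw [ENat.card_eq_coe_natCard]; exact_mod_cast hα
  by_cases hline : RainbowFree f 1 1 1
  · by_cases hconst : ∀ x y, f x = f y
    · exact ncard_range_le_of_dependsOn (i := 0) fun x y _ ↦ hconst x y
    push Not at hconst
    obtain ⟨_, _, hne⟩ := hconst
    obtain ⟨x, i, a, hne⟩ := exists_apply_update_ne hne
    have hsub : Set.range f ⊆ {f x, f (update x i a)} := by
      rintro _ ⟨w, rfl⟩
      exact hf.eq_or_eq_of_messy hα' hline hne.symm w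
    have := Set.ncard_le_ncard hsub
    have := Set.ncard_insert_le (f x) {f (update x i a)}
    have := Set.ncard_singleton (f (update x i a))
    lia
  · obtain ⟨i, hi⟩ := hf.exists_dependsOn_of_messy hα' hline
    exact ncard_range_le_of_dependsOn hi

end Messy

theorem exists_cell {i j k : Fin 3} (hij : i ≠ j) (hik : i ≠ k) (hjk : j ≠ k) (a b c : α) :
    ∃ w : Fin 3 → α, w i = a ∧ w j = b ∧ w k = c :=
  ⟨update (update (fun _ ↦ c) j b) i a, by simp [hij.symm, hik.symm, hjk.symm]⟩

section Loose

variable [DecidableEq α] {f : (Fin 3 → α) → κ} {x y z : Fin 3 → α}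

theorem hammingDist_eq_three_iff : hammingDist x y = 3 ↔ ∀ i, x i ≠ y i := by
  simpa using hammingDist_eq_card_iff (x := x) (y := y)

theorem hammingDist_eq_two_iff :
    hammingDist x y = 2 ↔ ∃ i, x i = y i ∧ ∀ j ≠ i, x j ≠ y j := by
  refine ⟨fun h ↦ ?_, fun ⟨i, hi, hne⟩ ↦ hammingDist_eq_card_sub_one hi hne⟩
  obtain ⟨i, hi⟩ : ∃ i, x i = y i := by
    by_contra! hne
    have := hammingDist_eq_three_iff.2 hne
    lia
  refine ⟨i, hi, fun j hj ↦ ?_⟩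
  obtain ⟨k, hki, hkj⟩ := exists_ne_ne i j
  rw [hammingDist_fin_three hj.symm hki.symm hkj.symm] at h
  grind

theorem RainbowFree.of_dist_three_three_three (hf : RainbowFree f 2 2 3) :
    RainbowFree f 3 3 3 := by
  intro x y z hxy hyz hxz
  obtain ⟨w, hw0, hw1, hw2⟩ := exists_cell (i := 0) (j := 1) (k := 2)
    (by decide) (by decide) (by decide) (x 0) (y 1) (z 2)
  rw [hammingDist_eq_three_iff] at hxy hyz hxz
  have triple {x y z : Fin 3 → α} := @hf x y z
  simp only [hammingDist_fin_three (show (0 : Fin 3) ≠ 1 by decide)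
    (show (0 : Fin 3) ≠ 2 by decide) (show (1 : Fin 3) ≠ 2 by decide)] at triple
  have hxy' := @triple x w y (by grind) (by grind) (by grind)
  have hyz' := @triple y w z (by grind) (by grind) (by grind)
  have hxz' := @triple x w z (by grind) (by grind) (by grind)
  grind

theorem RainbowFree.of_dist_two_three_three (hf : RainbowFree f 2 2 3) (hα : 3 ≤ ENat.card α) :
    RainbowFree f 2 3 3 := by
  intro x y z hxy hyz hxz
  obtain ⟨i, hi, hxyne⟩ := hammingDist_eq_two_iff.1 hxy
  rw [hammingDist_eq_three_iff] at hyz hxz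
  obtain ⟨j, hji, -⟩ := exists_ne_ne i i
  obtain ⟨k, hki, hkj⟩ := exists_ne_ne i j
  obtain ⟨t, htx, htz⟩ := ENat.exists_ne_ne_of_three_le hα (x i) (z i)
  obtain ⟨u, hui, huj, huk⟩ := exists_cell hji.symm hki.symm hkj.symm t (z j) (y k)
  obtain ⟨v, hvi, hvj, hvk⟩ := exists_cell hji.symm hki.symm hkj.symm (z i) (x j) (y k)
  have triple {x y z : Fin 3 → α} := @hf x y z
  simp only [hammingDist_fin_three hji.symm hki.symm hkj.symm] at triple
  have hu₁ := @triple y u z (by grind) (by grind) (by grind)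
  have hu₂ := @triple x y u (by grind) (by grind) (by grind)
  have hv₁ := @triple x v z (by grind) (by grind) (by grind)
  have hv₂ := @triple y v z (by grind) (by grind) (by grind)
  have huv := @triple x v u (by grind) (by grind) (by grind)
  grind

theorem RainbowFree.not_rainbow_of_common_coord (hf : RainbowFree f 2 2 3) (hα : 3 ≤ ENat.card α)
    {i : Fin 3} (hxy : x i = y i) (hyz : y i = z i) (hxyne : ∀ l ≠ i, x l ≠ y l)
    (hyzne : ∀ l ≠ i, y l ≠ z l) (hxzne : ∀ l ≠ i, x l ≠ z l) :
    f x = f y ∨ f y = f z ∨ f x = f z := by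
  obtain ⟨j, hji, -⟩ := exists_ne_ne i i
  obtain ⟨k, hki, hkj⟩ := exists_ne_ne i j
  obtain ⟨s, hs, -⟩ := ENat.exists_ne_ne_of_three_le hα (x i) (x i)
  obtain ⟨t, ht, hts⟩ := ENat.exists_ne_ne_of_three_le hα (x i) s
  obtain ⟨u, hui, huj, huk⟩ := exists_cell hji.symm hki.symm hkj.symm s (x j) (z k)
  obtain ⟨v, hvi, hvj, hvk⟩ := exists_cell hji.symm hki.symm hkj.symm t (y j) (x k)
  have triple {x y z : Fin 3 → α} := @hf x y z
  simp only [hammingDist_fin_three hji.symm hki.symm hkj.symm] at triple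
  have hu₁ := @triple u x y (by grind) (by grind) (by grind)
  have hu₂ := @triple u z y (by grind) (by grind) (by grind)
  have hv₁ := @triple v x z (by grind) (by grind) (by grind)
  have hv₂ := @triple v y z (by grind) (by grind) (by grind)
  have huv := @triple u x v (by grind) (by grind) (by grind)
  grind

theorem RainbowFree.not_rainbow_of_cyclic_coords (hf : RainbowFree f 2 2 3) (hα : 3 ≤ ENat.card α)
    {i j k : Fin 3} (hij : i ≠ j) (hik : i ≠ k) (hjk : j ≠ k) (hxy : x i = y i) (hyz : y j = z j)
    (hxz : x k = z k) (hxyne : ∀ l ≠ i, x l ≠ y l) (hyzne : ∀ l ≠ j, y l ≠ z l) :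
    f x = f y ∨ f y = f z ∨ f x = f z := by
  obtain ⟨r, hrx, hrz⟩ := ENat.exists_ne_ne_of_three_le hα (x i) (z i)
  obtain ⟨s, hsx, hsy⟩ := ENat.exists_ne_ne_of_three_le hα (x j) (y j)
  obtain ⟨t, htx, hty⟩ := ENat.exists_ne_ne_of_three_le hα (x k) (y k)
  obtain ⟨u, hui, huj, huk⟩ := exists_cell hij hik hjk r s (y k)
  obtain ⟨v, hvi, hvj, hvk⟩ := exists_cell hij hik hjk (x i) s t
  have triple {x y z : Fin 3 → α} := @hf x y z
  simp only [hammingDist_fin_three hij hik hjk] at triple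
  have hu₁ := @triple x y u (by grind) (by grind) (by grind)
  have hu₂ := @triple z y u (by grind) (by grind) (by grind)
  have hv₁ := @triple v x z (by grind) (by grind) (by grind)
  have hv₂ := @triple v y z (by grind) (by grind) (by grind)
  have huv := @triple x v u (by grind) (by grind) (by grind)
  grind

theorem RainbowFree.of_dist_two_two_two (hf : RainbowFree f 2 2 3) (hα : 3 ≤ ENat.card α) :
    RainbowFree f 2 2 2 := by
  intro x y z hxy hyz hxz
  obtain ⟨i, hi, hxyne⟩ := hammingDist_eq_two_iff.1 hxy
  obtain ⟨j, hj, hyzne⟩ := hammingDist_eq_two_iff.1 hyz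
  obtain ⟨k, hk, hxzne⟩ := hammingDist_eq_two_iff.1 hxz
  rcases eq_or_ne i j with rfl | hij
  · obtain rfl : i = k := by grind
    exact hf.not_rainbow_of_common_coord hα hi hj hxyne hyzne hxzne
  · exact hf.not_rainbow_of_cyclic_coords hα hij (by grind) (by grind) hi hj hk hxyne hyzne

theorem RainbowFree.not_rainbow_of_two_le (hf : RainbowFree f 2 2 3) (hα : 3 ≤ ENat.card α)
    (hxy : 2 ≤ hammingDist x y) (hyz : 2 ≤ hammingDist y z) (hxz : 2 ≤ hammingDist x z) :
    f x = f y ∨ f y = f z ∨ f x = f z := by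
  have two_or_three {x y : Fin 3 → α} (h : 2 ≤ hammingDist x y) :
      hammingDist x y = 2 ∨ hammingDist x y = 3 := by
    have : hammingDist x y ≤ 3 := hammingDist_le_card_fintype
    lia
  have loose {x y z : Fin 3 → α} := @hf x y z
  have far {x y z : Fin 3 → α} := hf.of_dist_three_three_three (x := x) (y := y) (z := z)
  have mixed {x y z : Fin 3 → α} := hf.of_dist_two_three_three hα (x := x) (y := y) (z := z)
  have near {x y z : Fin 3 → α} := hf.of_dist_two_two_two hα (x := x) (y := y) (z := z)
  have comm := hammingDist_comm (β := fun _ : Fin 3 ↦ α)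
  rcases two_or_three hxy with hxy | hxy <;> rcases two_or_three hyz with hyz | hyz <;>
    rcases two_or_three hxz with hxz | hxz <;> grind

theorem RainbowFree.meet_of_two_le (hf : RainbowFree f 2 2 3) (hα : 3 ≤ ENat.card α)
    {x₁ y₁ x₂ y₂ : Fin 3 → α} (h₁ : 2 ≤ hammingDist x₁ y₁) (h₂ : 2 ≤ hammingDist x₂ y₂)
    (hne₁ : f x₁ ≠ f y₁) (hne₂ : f x₂ ≠ f y₂) :
    f x₁ = f x₂ ∨ f x₁ = f y₂ ∨ f y₁ = f x₂ ∨ f y₁ = f y₂ := by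
  by_contra! hdisj
  obtain ⟨w, hw⟩ := exists_forall_ne hα x₁ y₁
  have hwx : hammingDist x₁ w = 3 := hammingDist_eq_three_iff.2 fun i ↦ (hw i).1.symm
  have hwy : hammingDist y₁ w = 3 := hammingDist_eq_three_iff.2 fun i ↦ (hw i).2.symm
  have far_of_ne {v : Fin 3 → α} (hx : f x₁ ≠ f v) (hy : f y₁ ≠ f v) : 2 ≤ hammingDist v w := by
    by_contra! hvw
    have hx₁ := hammingDist_triangle x₁ v w
    have hy₁ := hammingDist_triangle y₁ v w
    have := hf.not_rainbow_of_two_le hα h₁ (z := v) (by lia) (by lia)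
    grind
  have hw₁ := hf.not_rainbow_of_two_le hα (z := w) h₁ (by lia) (by lia)
  have hw₂ := hf.not_rainbow_of_two_le hα (z := w) h₂ (far_of_ne (by grind) (by grind))
    (far_of_ne (by grind) (by grind))
  grind

end Loose

section Star

/-- The graph on the colours of `f` whose edges are the pairs of distinct colours that occur on two
cells at Hamming distance at least two. -/
def farGraph [Fintype ι] [DecidableEq α] (f : (ι → α) → κ) : SimpleGraph κ where
  Adj p q := p ≠ q ∧ ∃ x y, 2 ≤ hammingDist x y ∧ f x = p ∧ f y = q
  symm := ⟨fun _ _ ⟨hne, x, y, hxy, hx, hy⟩ ↦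
    ⟨hne.symm, y, x, hammingDist_comm x y ▸ hxy, hy, hx⟩⟩
  loopless := ⟨fun _ h ↦ h.1 rfl⟩

theorem exists_star_of_forall_adj_meet {V : Type*} {G : SimpleGraph V}
    (hG : ∀ ⦃a b c d⦄, G.Adj a b → G.Adj c d → a = c ∨ a = d ∨ b = c ∨ b = d)
    (hcard : 3 < G.support.ncard) : ∃ p, ∀ ⦃a b⦄, G.Adj a b → p = a ∨ p = b := by
  by_contra! hstar
  obtain ⟨a, ha⟩ : G.support.Nonempty := Set.nonempty_of_ncard_ne_zero (by lia)
  obtain ⟨b, hab⟩ := G.mem_support.1 ha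
  have hbc : ∃ c, G.Adj b c ∧ a ≠ c := by
    obtain ⟨c, d, hcd, hac, had⟩ := hstar a
    have := hG hab hcd
    grind [G.adj_symm hcd]
  obtain ⟨c, hbc, hac⟩ := hbc
  have hca : G.Adj c a := by
    obtain ⟨d, e, hde, hbd, hbe⟩ := hstar b
    have := hG hab hde
    have := hG hbc hde
    grind [G.adj_symm hde]
  have hsub : G.support ⊆ {a, b, c} := by
    intro v hv
    obtain ⟨w, hvw⟩ := G.mem_support.1 hv
    have := hG hab hvw
    have := hG hbc hvw
    have := hG hca hvw
    have := hab.ne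
    have := hbc.ne
    grind
  have := Set.ncard_le_ncard hsub
  have := Set.ncard_insert_le a {b, c}
  have := Set.ncard_insert_le b {c}
  have := Set.ncard_singleton c
  lia

theorem exists_subset_range_update [Fintype ι] [DecidableEq ι] [Nonempty ι] [DecidableEq α]
    {S : Set (ι → α)} (hne : S.Nonempty) (hS : ∀ x ∈ S, ∀ y ∈ S, hammingDist x y ≤ 1) :
    ∃ x i, S ⊆ Set.range (update x i) := by
  obtain ⟨x, hx⟩ := hne
  have eq_update {y : ι → α} (hy : y ∈ S) (hxy : y ≠ x) : ∃ i a, x i ≠ a ∧ y = update x i a :=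
    hammingDist_eq_one_iff.1 ((hS x hx y hy).antisymm (hammingDist_pos.2 hxy.symm))
  by_cases hy : ∃ y ∈ S, y ≠ x
  · obtain ⟨y, hy, hyx⟩ := hy
    obtain ⟨i, a, ha, rfl⟩ := eq_update hy hyx
    refine ⟨x, i, fun z hz ↦ ?_⟩
    rcases eq_or_ne z x with rfl | hzx
    · exact ⟨z i, update_eq_self i z⟩
    obtain ⟨j, b, hb, rfl⟩ := eq_update hz hzx
    obtain rfl : i = j := by
      by_contra hij
      have := hS _ hy _ hz
      rw [hammingDist_update_update hij ha.symm hb.symm] at this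
      lia
    exact ⟨b, rfl⟩
  · push Not at hy
    obtain ⟨i⟩ := ‹Nonempty ι›
    exact ⟨x, i, fun z hz ↦ ⟨x i, by rw [update_eq_self, hy z hz]⟩⟩

theorem ncard_le_of_hammingDist_le_one [Fintype ι] [Nonempty ι] [Finite α] [DecidableEq α]
    {S : Set (ι → α)} (hS : ∀ x ∈ S, ∀ y ∈ S, hammingDist x y ≤ 1) : S.ncard ≤ Nat.card α := by
  classical
  rcases S.eq_empty_or_nonempty with rfl | hne
  · simp
  obtain ⟨x, i, hsub⟩ := exists_subset_range_update hne hS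
  exact (Set.ncard_le_ncard hsub (Set.finite_range _)).trans (Finite.card_range_le _)

theorem ncard_range_le_of_star [Fintype ι] [Nonempty ι] [Finite α] [DecidableEq α]
    {f : (ι → α) → κ} {p : κ} (hp : ∀ ⦃a b⦄, (farGraph f).Adj a b → p = a ∨ p = b) :
    (Set.range f).ncard ≤ Nat.card α + 1 := by
  obtain ⟨S, -, hS⟩ := Set.SurjOn.exists_bijOn_subset
    (show Set.SurjOn f Set.univ (Set.range f \ {p}) from Set.image_univ ▸ Set.sdiff_subset)
  have hclose : ∀ x ∈ S, ∀ y ∈ S, hammingDist x y ≤ 1 := by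
    intro x hx y hy
    by_contra! hxy
    have hne : f x ≠ f y := fun h ↦ by simp [hS.injOn hx hy h] at hxy
    rcases hp ⟨hne, x, y, hxy, rfl, rfl⟩ with h | h
    · exact (hS.mapsTo hx).2 h.symm
    · exact (hS.mapsTo hy).2 h.symm
  calc (Set.range f).ncard ≤ (Set.range f \ {p}).ncard + ({p} : Set κ).ncard :=
        Set.ncard_le_ncard_sdiff_add_ncard _ _
    _ = S.ncard + 1 := by rw [Set.ncard_singleton, ← hS.image_eq, hS.injOn.ncard_image]
    _ ≤ Nat.card α + 1 := by gcongr; exact ncard_le_of_hammingDist_le_one hclose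

theorem range_subset_support_farGraph [Fintype ι] [DecidableEq α] {f : (ι → α) → κ}
    (hι : 2 ≤ Fintype.card ι) (hα : 3 ≤ ENat.card α) (hf : (Set.range f).Nontrivial) :
    Set.range f ⊆ (farGraph f).support := by
  rintro _ ⟨x, rfl⟩
  obtain ⟨_, ⟨y, rfl⟩, hyx⟩ := hf.exists_ne (f x)
  obtain ⟨w, hw⟩ := exists_forall_ne hα x y
  have hwx : hammingDist x w = Fintype.card ι := hammingDist_eq_card_iff.2 fun i ↦ (hw i).1.symm
  have hwy : hammingDist w y = Fintype.card ι := hammingDist_eq_card_iff.2 fun i ↦ (hw i).2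
  by_cases h : f w = f x
  · exact ⟨f y, hyx.symm, w, y, hι.trans hwy.ge, h, rfl⟩
  · exact ⟨f w, Ne.symm h, x, w, hι.trans hwx.ge, rfl, rfl⟩

theorem RainbowFree.ncard_range_le_of_loose [DecidableEq α] {f : (Fin 3 → α) → κ}
    (hf : RainbowFree f 2 2 3) (hα : 3 ≤ Nat.card α) :
    (Set.range f).ncard ≤ Nat.card α + 1 := by
  have : Finite α := Nat.finite_of_card_ne_zero (by lia)
  have hα' : 3 ≤ ENat.card α := by rw [ENat.card_eq_coe_natCard]; exact_mod_cast hα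
  by_contra! hlt
  have hfin : (farGraph f).support.Finite := by
    refine (Set.finite_range f).subset ?_
    rintro _ ⟨_, -, x, _, -, rfl, -⟩
    exact ⟨x, rfl⟩
  have hsub := range_subset_support_farGraph (f := f) (by decide) hα'
    ((Set.one_lt_ncard_iff_nontrivial_and_finite.1 (by lia)).1)
  have hmeet : ∀ ⦃a b c d⦄, (farGraph f).Adj a b → (farGraph f).Adj c d →
      a = c ∨ a = d ∨ b = c ∨ b = d := by
    rintro _ _ _ _ ⟨hne₁, x₁, y₁, h₁, rfl, rfl⟩ ⟨hne₂, x₂, y₂, h₂, rfl, rfl⟩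
    exact hf.meet_of_two_le hα' h₁ h₂ hne₁ hne₂
  obtain ⟨p, hp⟩ := exists_star_of_forall_adj_meet hmeet
    (by have := Set.ncard_le_ncard hsub hfin; lia)
  exact hlt.not_ge (ncard_range_le_of_star hp)

end Star

section LowerBound

variable [Fintype ι] [DecidableEq α] {f : (ι → α) → κ} {p q s : ℕ}

theorem eq_or_eq_of_hammingDist_add_eq {x y z : ι → α}
    (h : hammingDist x y + hammingDist y z = hammingDist x z) (i : ι) : y i = x i ∨ y i = z i := by
  by_contra! hi
  let S (u v : ι → α) : Finset ι := {j | u j ≠ v j}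
  have hlt : (S x z).card < (S x y).card + (S y z).card := by
    classical
    rw [← Finset.card_union_add_card_inter]
    have hle : (S x z).card ≤ (S x y ∪ S y z).card :=
      Finset.card_le_card fun j ↦ by simp only [S, Finset.mem_union, Finset.mem_filter_univ]; grind
    have hpos : 0 < (S x y ∩ S y z).card :=
      Finset.card_pos.2 ⟨i, by simpa [S] using ⟨hi.1.symm, hi.2⟩⟩
    lia
  exact hlt.ne' h

theorem rainbowFree_of_dependsOn {i : ι} (hf : DependsOn f {i}) : RainbowFree f p q (p + q) := by
  rintro x y z rfl rfl hxz
  rcases eq_or_eq_of_hammingDist_add_eq hxz.symm i with h | h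
  · exact Or.inl (hf (by simpa using h.symm))
  · exact Or.inr (Or.inl (hf (by simpa using h)))

theorem rainbowFree_extend {m : ℕ} {g : Fin m → ι → α} (hg : Injective g)
    (hdist : ∀ a b, a ≠ b → hammingDist (g a) (g b) ∉ ({p, q, s} : Set ℕ)) :
    RainbowFree (extend g (fun a ↦ (a : ℕ) + 1) 0) p q s := by
  have apply_eq (x : ι → α) : extend g (fun a ↦ (a : ℕ) + 1) 0 x = 0 ∨
      ∃ a, g a = x ∧ extend g (fun a ↦ (a : ℕ) + 1) 0 x = a + 1 := by
    by_cases hx : ∃ a, g a = x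
    · obtain ⟨a, rfl⟩ := hx
      exact Or.inr ⟨a, rfl, hg.extend_apply _ _ a⟩
    · exact Or.inl (extend_apply' _ _ _ hx)
  intro x y z hxy hyz hxz
  simp only [Set.mem_insert_iff, Set.mem_singleton_iff, not_or] at hdist
  have := apply_eq x
  have := apply_eq y
  have := apply_eq z
  grind

theorem ncard_range_extend {β : Type*} {m : ℕ} {g : Fin m → β} (hg : Injective g)
    (hsurj : ¬ Surjective g) :
    (Set.range (extend g (fun a ↦ (a : ℕ) + 1) 0)).ncard = m + 1 := by
  have hrange : Set.range (extend g (fun a ↦ (a : ℕ) + 1) 0) = Set.Iio (m + 1) := by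
    refine Set.Subset.antisymm ?_ ?_
    · rintro _ ⟨x, rfl⟩
      by_cases hx : ∃ a, g a = x
      · obtain ⟨a, rfl⟩ := hx
        simp [hg.extend_apply]
      · simp [extend_apply' _ _ _ hx]
    · rintro (_ | l) hl
      · obtain ⟨x, hx⟩ := not_forall.1 hsurj
        exact ⟨x, extend_apply' _ _ _ hx⟩
      · have hl : l < m := by simpa using hl
        exact ⟨g ⟨l, hl⟩, hg.extend_apply _ _ _⟩
  rw [hrange, Set.ncard_eq_toFinset_card']
  simp

end LowerBound

section Bridge

theorem hammingDist_add_ncard_inter [Fintype ι] [DecidableEq α] (x y : ι → α) :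
    hammingDist x y + (Set.univ.graphOn x ∩ Set.univ.graphOn y).ncard = Fintype.card ι := by
  have hinter : Set.univ.graphOn x ∩ Set.univ.graphOn y = Set.graphOn x {i | x i = y i} := by
    ext ⟨i, a⟩
    simp only [Set.mem_inter_iff, Set.mem_graphOn, Set.mem_univ, true_and, Set.mem_ofPred_eq]
    grind
  rw [hinter, Set.ncard_graphOn, Set.ncard_eq_toFinset_card', Set.toFinset_ofPred, add_comm,
    hammingDist, Finset.card_filter_add_card_filter_not, Finset.card_univ]

theorem hammingDist_add_ncard_inter_of_image {β : Type*} [Fintype ι] [DecidableEq α]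
    {φ : β → ι × α} (hφ : Injective φ) {A B : Set β} {x y : ι → α}
    (hA : φ '' A = Set.univ.graphOn x) (hB : φ '' B = Set.univ.graphOn y) :
    hammingDist x y + (A ∩ B).ncard = Fintype.card ι := by
  rw [← hammingDist_add_ncard_inter x y, ← hA, ← hB, ← Set.image_inter hφ,
    Set.ncard_image_of_injective _ hφ]

variable {r n : ℕ}

theorem mem_edgeSet_completePartite {e : Set (Fin r × Fin n)} :
    e ∈ (completePartite r n).edgeSet ↔ ∃ x, Set.univ.graphOn x = e := by
  constructor
  · rintro ⟨-, he⟩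
    choose v hv using fun i ↦ Set.ncard_eq_one.1 (he i)
    have mem_iff (i : Fin r) (w : Fin r × Fin n) : w ∈ e ∧ w.1 = i ↔ w = v i := by
      simpa using Set.ext_iff.1 (hv i) w
    refine ⟨fun i ↦ (v i).2, Set.ext fun ⟨i, a⟩ ↦ ?_⟩
    have hi := (mem_iff i (v i)).2 rfl
    have hia := mem_iff i (i, a)
    simp only [Set.mem_graphOn, Set.mem_univ, true_and]
    grind
  · rintro ⟨x, rfl⟩
    refine ⟨by simp [Set.ncard_univ], fun i ↦ Set.ncard_eq_one.2 ⟨(i, x i), ?_⟩⟩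
    ext ⟨j, a⟩
    simp only [Set.mem_inter_iff, Set.mem_graphOn, Set.mem_univ, true_and, Set.mem_ofPred_eq,
      Set.mem_singleton_iff, Prod.mk.injEq]
    grind

/-- The edges of the complete `r`-partite hypergraph, viewed as the cells of the cube: a cell `x`
stands for the edge whose vertex in the `i`-th partite set is `(i, x i)`. -/
noncomputable def edgeEquiv (r n : ℕ) : (Fin r → Fin n) ≃ (completePartite r n).edgeSet :=
  Equiv.ofBijective (fun x ↦ ⟨Set.univ.graphOn x, mem_edgeSet_completePartite.2 ⟨x, rfl⟩⟩)
    ⟨fun _ _ h ↦ Set.graphOn_univ_injective (congrArg Subtype.val h),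
      fun ⟨_, he⟩ ↦ (mem_edgeSet_completePartite.1 he).imp fun _ hx ↦ Subtype.ext hx⟩

variable {β : Type*} {G : Hypergraph β} {A B D : Set β}

theorem hasRainbowCopy_completePartite_iff (hV : G.vertexSet = Set.univ)
    (hE : G.edgeSet = {A, B, D}) (hAB : A ≠ B) (hBD : B ≠ D) (hAD : A ≠ D)
    {c : (completePartite r n).edgeSet → ℕ} :
    HasRainbowCopy (completePartite r n) c G ↔ ∃ x y z : Fin r → Fin n,
      (∃ φ : β → Fin r × Fin n, Injective φ ∧ φ '' A = Set.univ.graphOn x ∧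
        φ '' B = Set.univ.graphOn y ∧ φ '' D = Set.univ.graphOn z) ∧
      c (edgeEquiv r n x) ≠ c (edgeEquiv r n y) ∧ c (edgeEquiv r n y) ≠ c (edgeEquiv r n z) ∧
      c (edgeEquiv r n x) ≠ c (edgeEquiv r n z) := by
  constructor
  · rintro ⟨φ, -, hφ, hedge, hrainbow⟩
    choose x hx using fun e : G.edgeSet ↦ (edgeEquiv r n).surjective ⟨φ '' e, hedge e e.2⟩
    have himage (e : G.edgeSet) : φ '' e = Set.univ.graphOn (x e) :=
      (congrArg Subtype.val (hx e)).symm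
    have hcolor {e e' : G.edgeSet} (he : e.1 ≠ e'.1) :
        c (edgeEquiv r n (x e)) ≠ c (edgeEquiv r n (x e')) := by
      rw [hx, hx]
      exact hrainbow.ne fun h ↦ he (congrArg Subtype.val h)
    let a : G.edgeSet := ⟨A, by simp [hE]⟩
    let b : G.edgeSet := ⟨B, by simp [hE]⟩
    let d : G.edgeSet := ⟨D, by simp [hE]⟩
    exact ⟨x a, x b, x d, ⟨φ, Set.injOn_univ.1 (hV ▸ hφ), himage a, himage b, himage d⟩,
      hcolor hAB, hcolor hBD, hcolor hAD⟩
  · rintro ⟨x, y, z, ⟨φ, hφ, hA, hB, hD⟩, hxy, hyz, hxz⟩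
    have hedge : ∀ e ∈ G.edgeSet, φ '' e ∈ (completePartite r n).edgeSet := by
      rw [hE]
      rintro e (rfl | rfl | rfl)
      exacts [mem_edgeSet_completePartite.2 ⟨x, hA.symm⟩,
        mem_edgeSet_completePartite.2 ⟨y, hB.symm⟩, mem_edgeSet_completePartite.2 ⟨z, hD.symm⟩]
    refine ⟨φ, fun _ _ ↦ Set.mem_univ _, hφ.injOn, hedge, ?_⟩
    rintro ⟨e, he⟩ ⟨e', he'⟩ heq
    have hAx : (⟨φ '' A, hedge A (by simp [hE])⟩ : (completePartite r n).edgeSet) =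
      edgeEquiv r n x := Subtype.ext hA
    have hBy : (⟨φ '' B, hedge B (by simp [hE])⟩ : (completePartite r n).edgeSet) =
      edgeEquiv r n y := Subtype.ext hB
    have hDz : (⟨φ '' D, hedge D (by simp [hE])⟩ : (completePartite r n).edgeSet) =
      edgeEquiv r n z := Subtype.ext hD
    rw [hE] at he he'
    rcases he with rfl | rfl | rfl <;> rcases he' with rfl | rfl | rfl <;> grind

theorem not_hasRainbowCopy_iff_rainbowFree (hV : G.vertexSet = Set.univ)
    (hE : G.edgeSet = {A, B, D}) (hAB : A ≠ B) (hBD : B ≠ D) (hAD : A ≠ D) {p q s : ℕ}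
    (hp : p + (A ∩ B).ncard = r) (hq : q + (B ∩ D).ncard = r) (hs : s + (A ∩ D).ncard = r)
    (hcopy : ∀ x y z : Fin r → Fin n, hammingDist x y = p → hammingDist y z = q →
      hammingDist x z = s → ∃ φ : β → Fin r × Fin n, Injective φ ∧
        φ '' A = Set.univ.graphOn x ∧ φ '' B = Set.univ.graphOn y ∧ φ '' D = Set.univ.graphOn z)
    (c : (completePartite r n).edgeSet → ℕ) :
    ¬ HasRainbowCopy (completePartite r n) c G ↔ RainbowFree (c ∘ edgeEquiv r n) p q s := by
  rw [hasRainbowCopy_completePartite_iff hV hE hAB hBD hAD]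
  constructor
  · intro h x y z hxy hyz hxz
    have := hcopy x y z hxy hyz hxz
    simp only [comp_apply]
    grind
  · rintro hf ⟨x, y, z, ⟨φ, hφ, hA, hB, hD⟩, hxy, hyz, hxz⟩
    have hdist_xy := hammingDist_add_ncard_inter_of_image hφ hA hB
    have hdist_yz := hammingDist_add_ncard_inter_of_image hφ hB hD
    have hdist_xz := hammingDist_add_ncard_inter_of_image hφ hA hD
    rw [Fintype.card_fin] at hdist_xy hdist_yz hdist_xz
    have := hf (x := x) (y := y) (z := z) (by lia) (by lia) (by lia)
    simp only [comp_apply] at this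
    tauto

theorem isAntiRamseyNumber_of_rainbowFree {m p q s : ℕ}
    (hG : ∀ c, ¬ HasRainbowCopy (completePartite r n) c G ↔
      RainbowFree (c ∘ edgeEquiv r n) p q s)
    (hupper : ∀ f : (Fin r → Fin n) → ℕ, RainbowFree f p q s → (Set.range f).ncard ≤ m)
    (hlower : ∃ f : (Fin r → Fin n) → ℕ, RainbowFree f p q s ∧ (Set.range f).ncard = m) :
    IsAntiRamseyNumber (completePartite r n) G (m + 1) := by
  refine ⟨fun c hc ↦ ?_, fun k hk ↦ ?_⟩
  · by_contra hcopy
    have := hupper _ ((hG c).1 hcopy)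
    rw [EquivLike.range_comp] at this
    lia
  · obtain ⟨f, hf, hcard⟩ := hlower
    by_contra! hlt
    refine (hG (f ∘ (edgeEquiv r n).symm)).2 ?_ (hk _ ?_)
    · simpa [comp_assoc] using hf
    · rw [EquivLike.range_comp]
      lia

end Bridge

section Paths

theorem graphOn_univ_eq {i j k : Fin 3} (hij : i ≠ j) (hik : i ≠ k) (hjk : j ≠ k)
    (x : Fin 3 → α) : Set.univ.graphOn x = {(i, x i), (j, x j), (k, x k)} := by
  have huniv : (Set.univ : Set (Fin 3)) = {i, j, k} := by
    ext l
    simpa using eq_or_eq_or_eq_of_ne hij hik hjk l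
  rw [huniv, Set.graphOn_insert, Set.graphOn_insert, Set.graphOn_singleton]

variable [DecidableEq α] {n : ℕ}

theorem exists_tight_image_eq_graphOn {x y z : Fin 3 → α} (hxy : hammingDist x y = 1)
    (hyz : hammingDist y z = 1) (hxz : hammingDist x z = 2) :
    ∃ φ : Fin 5 → Fin 3 × α, Injective φ ∧ φ '' {0, 1, 2} = Set.univ.graphOn x ∧
      φ '' {1, 2, 3} = Set.univ.graphOn y ∧ φ '' {2, 3, 4} = Set.univ.graphOn z := by
  obtain ⟨i, a, ha, rfl⟩ := hammingDist_eq_one_iff.1 hxy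
  obtain ⟨j, b, hb, rfl⟩ := hammingDist_eq_one_iff.1 hyz
  have hij : i ≠ j := by
    rintro rfl
    rw [update_idem, hammingDist_comm] at hxz
    rcases eq_or_ne b (x i) with rfl | hbx
    · simp at hxz
    · simp [hammingDist_update_self hbx] at hxz
  obtain ⟨k, hki, hkj⟩ := exists_ne_ne i j
  rw [update_of_ne hij.symm] at hb
  refine ⟨![(i, x i), (j, x j), (k, x k), (i, a), (j, b)], ?_, ?_, ?_, ?_⟩
  · rw [← List.nodup_ofFn]
    simp [hij, hij.symm, hki, hki.symm, hkj, hkj.symm, ha, hb]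
  · simp [Set.image_insert_eq, graphOn_univ_eq hij hki.symm hkj.symm]
  · simp [Set.image_insert_eq, graphOn_univ_eq hkj.symm hij.symm hki, hij.symm, hki]
  · simp [Set.image_insert_eq, graphOn_univ_eq hki hkj hij, hij, hki, hkj]

theorem exists_messy_image_eq_graphOn {x y z : Fin 3 → α} (hxy : hammingDist x y = 1)
    (hyz : hammingDist y z = 2) (hxz : hammingDist x z = 3) :
    ∃ φ : Fin 6 → Fin 3 × α, Injective φ ∧ φ '' {0, 1, 2} = Set.univ.graphOn x ∧
      φ '' {1, 2, 3} = Set.univ.graphOn y ∧ φ '' {3, 4, 5} = Set.univ.graphOn z := by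
  obtain ⟨l, a, ha, rfl⟩ := hammingDist_eq_one_iff.1 hxy
  obtain ⟨i, hi, hyz⟩ := hammingDist_eq_two_iff.1 hyz
  have hxz := hammingDist_eq_three_iff.1 hxz
  obtain rfl : l = i := by
    by_contra hli
    exact hxz i (by rwa [update_of_ne (Ne.symm hli)] at hi)
  obtain ⟨j, hjl, -⟩ := exists_ne_ne l l
  obtain ⟨k, hkl, hkj⟩ := exists_ne_ne l j
  rw [update_self] at hi
  refine ⟨![(l, x l), (j, x j), (k, x k), (l, a), (j, z j), (k, z k)], ?_, ?_, ?_, ?_⟩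
  · rw [← List.nodup_ofFn]
    simp [hjl, hjl.symm, hkl, hkl.symm, hkj, hkj.symm, ha, hxz]
  · simp [Set.image_insert_eq, graphOn_univ_eq hjl.symm hkl.symm hkj.symm]
  · simp [Set.image_insert_eq, graphOn_univ_eq hkj.symm hjl hkl, hjl, hkl]
  · simp [Set.image_insert_eq, graphOn_univ_eq hjl.symm hkl.symm hkj.symm, hi]

theorem exists_loose_image_eq_graphOn {x y z : Fin 3 → α} (hxy : hammingDist x y = 2)
    (hyz : hammingDist y z = 2) (hxz : hammingDist x z = 3) :
    ∃ φ : Fin 7 → Fin 3 × α, Injective φ ∧ φ '' {0, 1, 2} = Set.univ.graphOn x ∧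
      φ '' {2, 3, 4} = Set.univ.graphOn y ∧ φ '' {4, 5, 6} = Set.univ.graphOn z := by
  obtain ⟨i, hi, hxy⟩ := hammingDist_eq_two_iff.1 hxy
  obtain ⟨j, hj, hyz⟩ := hammingDist_eq_two_iff.1 hyz
  have hxz := hammingDist_eq_three_iff.1 hxz
  have hij : i ≠ j := by
    rintro rfl
    exact hxz i (hi.trans hj)
  obtain ⟨k, hki, hkj⟩ := exists_ne_ne i j
  refine ⟨![(j, x j), (k, x k), (i, x i), (k, y k), (j, y j), (i, z i), (k, z k)], ?_, ?_, ?_, ?_⟩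
  · rw [← List.nodup_ofFn]
    simp [hij, hij.symm, hki, hki.symm, hkj, hkj.symm, hxy k hki, hxy j hij.symm, hyz k hkj, hxz]
  · simp [Set.image_insert_eq, graphOn_univ_eq hkj.symm hij.symm hki]
  · simp [Set.image_insert_eq, graphOn_univ_eq hki.symm hij hkj, hi]
  · simp [Set.image_insert_eq, graphOn_univ_eq hij.symm hkj.symm hki.symm, hj]

theorem not_hasRainbowCopy_tightPath_iff (c : (completePartite 3 n).edgeSet → ℕ) :
    ¬ HasRainbowCopy (completePartite 3 n) c tightPath ↔
      RainbowFree (c ∘ edgeEquiv 3 n) 1 1 2 := by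
  refine not_hasRainbowCopy_iff_rainbowFree rfl rfl ?_ ?_ ?_ ?_ ?_ ?_
    (fun _ _ _ ↦ exists_tight_image_eq_graphOn) c
  all_goals simp [Set.ext_iff, Fin.forall_fin_succ, Set.ncard_eq_toFinset_card']

theorem not_hasRainbowCopy_messyPath_iff (c : (completePartite 3 n).edgeSet → ℕ) :
    ¬ HasRainbowCopy (completePartite 3 n) c messyPath ↔
      RainbowFree (c ∘ edgeEquiv 3 n) 1 2 3 := by
  refine not_hasRainbowCopy_iff_rainbowFree rfl rfl ?_ ?_ ?_ ?_ ?_ ?_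
    (fun _ _ _ ↦ exists_messy_image_eq_graphOn) c
  all_goals simp [Set.ext_iff, Fin.forall_fin_succ, Set.ncard_eq_toFinset_card']

theorem not_hasRainbowCopy_loosePath_iff (c : (completePartite 3 n).edgeSet → ℕ) :
    ¬ HasRainbowCopy (completePartite 3 n) c loosePath ↔
      RainbowFree (c ∘ edgeEquiv 3 n) 2 2 3 := by
  refine not_hasRainbowCopy_iff_rainbowFree rfl rfl ?_ ?_ ?_ ?_ ?_ ?_
    (fun _ _ _ ↦ exists_loose_image_eq_graphOn) c
  all_goals simp [Set.ext_iff, Fin.forall_fin_succ, Set.ncard_eq_toFinset_card']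

end Paths

section Extremal

variable {n : ℕ}

theorem exists_rainbowFree_tight (hn : 2 ≤ n) : ∃ f : (Fin 3 → Fin n) → ℕ,
    RainbowFree f 1 1 2 ∧ (Set.range f).ncard = n + 1 := by
  have hg : Injective fun (a : Fin n) (_ : Fin 3) ↦ a := const_injective
  refine ⟨_, rainbowFree_extend hg fun a b hab ↦ ?_, ncard_range_extend hg fun hsurj ↦ ?_⟩
  · simp [hammingDist_eq_three_iff.2 fun _ ↦ hab]
  · obtain ⟨a, ha⟩ := hsurj ![⟨0, by lia⟩, ⟨1, by lia⟩, ⟨1, by lia⟩]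
    simpa using (congrFun ha 0).symm.trans (congrFun ha 1)

theorem exists_rainbowFree_messy (n : ℕ) : ∃ f : (Fin 3 → Fin n) → ℕ,
    RainbowFree f 1 2 3 ∧ (Set.range f).ncard = n := by
  refine ⟨fun x ↦ x 0, rainbowFree_of_dependsOn (i := 0) fun x y h ↦ by simp [h 0 rfl], ?_⟩
  have hrange : Set.range (fun x : Fin 3 → Fin n ↦ (x 0 : ℕ)) = Set.range Fin.val :=
    Surjective.range_comp (f := fun x : Fin 3 → Fin n ↦ x 0) (fun a ↦ ⟨fun _ ↦ a, rfl⟩) Fin.val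
  rw [hrange, ← Set.image_univ, Set.ncard_image_of_injective _ Fin.val_injective, Set.ncard_univ,
    Nat.card_fin]

theorem exists_rainbowFree_loose (hn : 2 ≤ n) : ∃ f : (Fin 3 → Fin n) → ℕ,
    RainbowFree f 2 2 3 ∧ (Set.range f).ncard = n + 1 := by
  let x : Fin 3 → Fin n := fun _ ↦ ⟨0, by lia⟩
  have hg : Injective (update x 0) := update_injective x 0
  refine ⟨_, rainbowFree_extend hg fun a b hab ↦ ?_, ncard_range_extend hg fun hsurj ↦ ?_⟩
  · have : hammingDist (update x 0 a) (update x 0 b) = 1 :=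
      hammingDist_eq_one_iff.2 ⟨0, b, by simpa using hab, by simp⟩
    simp [this]
  · obtain ⟨a, ha⟩ := hsurj fun _ ↦ ⟨1, by lia⟩
    simpa [x] using congrFun ha 1

end Extremal

end AntiRamsey

theorem mainTheorem11 (n : ℕ) (hn : 3 ≤ n) :
    AntiRamsey.IsAntiRamseyNumber (AntiRamsey.completePartite 3 n) AntiRamsey.messyPath (n + 1) ∧
    AntiRamsey.IsAntiRamseyNumber (AntiRamsey.completePartite 3 n) AntiRamsey.tightPath (n + 2) ∧
    AntiRamsey.IsAntiRamseyNumber (AntiRamsey.completePartite 3 n) AntiRamsey.loosePath (n + 2) := by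
  have hα : 3 ≤ Nat.card (Fin n) := by rwa [Nat.card_fin]
  open AntiRamsey in
  refine ⟨isAntiRamseyNumber_of_rainbowFree not_hasRainbowCopy_messyPath_iff
      (fun f hf ↦ ?_) (exists_rainbowFree_messy n),
    isAntiRamseyNumber_of_rainbowFree not_hasRainbowCopy_tightPath_iff
      (fun f hf ↦ ?_) (exists_rainbowFree_tight (by lia)),
    isAntiRamseyNumber_of_rainbowFree not_hasRainbowCopy_loosePath_iff
      (fun f hf ↦ ?_) (exists_rainbowFree_loose (by lia))⟩
  · simpa only [Nat.card_fin] using hf.ncard_range_le_of_messy hα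
  · simpa only [Nat.card_fin] using hf.ncard_range_le_of_tight
  · simpa only [Nat.card_fin] using hf.ncard_range_le_of_loose hα
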